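/- **Theorem.** Let $a,b\ge 1$. A grid-labelled graph $G$ of type $(a,b)$ is a simple graph with a bijective labelling of its vertices by $[a]\times[b]$; we identify vertices with their labels. Assume that $G$ has $m\ge 1$ edges, let $D(G)$ be its degree matrix and $L(G)=D(G)-A(G)$ its combinatorial Laplacian, and put $\rho(G)=L(G)/2m$, a density matrix on $\mathbb{C}^a\otimes\mathbb{C}^b$. Call $G$ *separable* if $\rho(G)=\sum_i p_i\,\rho_i\otimes\sigma_i$ is a finite convex combination of tensor products of density matrices $\rho_i$ on $\mathbb{C}^a$ and $\sigma_i$ on $\mathbb{C}^b$. The partial transpose $\Gamma(G)$ is the grid-labelled graph obtained by replacing every edge $\{(i,j),(k,l)\}$ of $G$ by $\{(k,j),(i,l)\}$, and $G$ satisfies the *degree criterion* if $D(G)=D(\Gamma(G))$. An edge $\{(i,j),(k,l)\}$ is *diagonal* if $i\ne k$ and $j\ne l$; $G$ is *row* (resp. *column*) *stratified* if $|i-k|=1$ (resp. $|j-l|=1$) for every diagonal edge $\{(i,j),(k,l)\}$. 1. If $G$ is row stratified or column stratified, then $G$ is separable if and only if it satisfies the degree criterion. Moreover $G$ is separable if and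 only if the partial transpose $\rho(G)^{\Gamma_A}$ is positive semidefinite, and also if and only if $\rho(G)^{\Gamma_B}$ is positive semidefinite, where $\langle i,j|\rho^{\Gamma_A}|k,l\rangle=\langle k,j|\rho|i,l\rangle$ and $\langle i,j|\rho^{\Gamma_B}|k,l\rangle=\langle i,l|\rho|k,j\rangle$. 2. For all $a,b\ge 2$ there are grid-labelled graphs of type $(a,b)$ that are both row and column stratified and have at least one diagonal edge, one of them separable and one of them not separable. So for all $a,b\ge2$ the states $\rho(G)$ of the stratified graphs with an edge are a family that contains separable and entangled states and for which the Peres–Horodecki (PPT) criterion is necessary and sufficient for separability. -/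

import Mathlib

open scoped Kronecker ComplexOrder

universe u

/-- A grid-labelled graph of type `(a, b)`: a simple graph together with a bijective labelling
of its vertices by the points of the grid `[a] × [b]`. The grid points are indexed from `0`. -/
structure GridLabelledGraph (a b : ℕ) where
  /-- The vertices. -/
  V : Type u
  /-- The underlying simple graph. -/
  graph : SimpleGraph V
  /-- The bijective labelling of the vertices. -/
  label : V ≃ Fin a × Fin b

/-- A density matrix: positive semidefinite of trace one. -/
def IsDensityMatrix {n : Type*} [Fintype n] (ρ : Matrix n n ℂ) : Prop :=
  ρ.PosSemidef ∧ ρ.trace = 1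

/-- Separability of a matrix on `ℂ^a ⊗ ℂ^b`: it is a finite convex combination of tensor
products of density matrices. -/
def IsSeparableState {a b : ℕ} (ρ : Matrix (Fin a × Fin b) (Fin a × Fin b) ℂ) : Prop :=
  ∃ (k : ℕ) (p : Fin k → ℝ) (σ : Fin k → Matrix (Fin a) (Fin a) ℂ)
    (τ : Fin k → Matrix (Fin b) (Fin b) ℂ),
    (∀ i, 0 ≤ p i) ∧ ∑ i, p i = 1 ∧
    (∀ i, IsDensityMatrix (σ i)) ∧ (∀ i, IsDensityMatrix (τ i)) ∧
    ρ = ∑ i, (p i : ℂ) • (σ i ⊗ₖ τ i)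

/-- Partial transpose of a matrix with respect to the first subsystem. -/
def partialTransposeA {a b : ℕ} (M : Matrix (Fin a × Fin b) (Fin a × Fin b) ℂ) :
    Matrix (Fin a × Fin b) (Fin a × Fin b) ℂ :=
  Matrix.of fun x y => M (y.1, x.2) (x.1, y.2)

/-- Partial transpose of a matrix with respect to the second subsystem. -/
def partialTransposeB {a b : ℕ} (M : Matrix (Fin a × Fin b) (Fin a × Fin b) ℂ) :
    Matrix (Fin a × Fin b) (Fin a × Fin b) ℂ :=
  Matrix.of fun x y => M (x.1, y.2) (y.1, x.2)

namespace GridLabelledGraph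

/-- The graph drawn on the grid: two grid points are adjacent if and only if the vertices
that they label are adjacent. -/
def onGrid {a b : ℕ} (G : GridLabelledGraph.{u} a b) : SimpleGraph (Fin a × Fin b) :=
  G.graph.map G.label.toEmbedding

open Classical in
/-- The number of edges. -/
noncomputable def edgeCount {a b : ℕ} (G : GridLabelledGraph.{u} a b) : ℕ :=
  G.onGrid.edgeFinset.card

open Classical in
/-- The degree matrix, indexed by the grid points. -/
noncomputable def degreeMatrix {a b : ℕ} (G : GridLabelledGraph.{u} a b) :
    Matrix (Fin a × Fin b) (Fin a × Fin b) ℂ :=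
  G.onGrid.degMatrix ℂ

open Classical in
/-- The combinatorial Laplacian (degree matrix minus adjacency matrix), indexed by the
grid points. -/
noncomputable def laplacian {a b : ℕ} (G : GridLabelledGraph.{u} a b) :
    Matrix (Fin a × Fin b) (Fin a × Fin b) ℂ :=
  G.onGrid.lapMatrix ℂ

/-- The matrix `L(G) / 2m`, where `m` is the number of edges. It is a density matrix as soon as
the graph has an edge. -/
noncomputable def densityMatrix {a b : ℕ} (G : GridLabelledGraph.{u} a b) :
    Matrix (Fin a × Fin b) (Fin a × Fin b) ℂ :=
  (1 / (2 * (G.edgeCount : ℂ))) • G.laplacian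

/-- The partial transpose of a grid-labelled graph: each edge with labels `(i, j)`, `(k, l)` is
replaced by the edge with labels `(k, j)`, `(i, l)`. -/
def partialTranspose {a b : ℕ} (G : GridLabelledGraph.{u} a b) : GridLabelledGraph.{u} a b where
  V := G.V
  graph :=
    { Adj := fun u v => G.onGrid.Adj ((G.label v).1, (G.label u).2) ((G.label u).1, (G.label v).2)
      symm := ⟨fun _ _ h => h.symm⟩
      loopless := ⟨fun _ h => h.ne rfl⟩ }
  label := G.label

/-- The degree criterion: the degree matrix is unchanged by the partial transpose. -/
def DegreeCriterion {a b : ℕ} (G : GridLabelledGraph.{u} a b) : Prop :=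
  G.degreeMatrix = G.partialTranspose.degreeMatrix

/-- The grid points `x` and `y` are joined by a diagonal edge. -/
def DiagonalEdge {a b : ℕ} (G : GridLabelledGraph.{u} a b) (x y : Fin a × Fin b) : Prop :=
  G.onGrid.Adj x y ∧ x.1 ≠ y.1 ∧ x.2 ≠ y.2

/-- Every diagonal edge joins adjacent rows. -/
def RowStratified {a b : ℕ} (G : GridLabelledGraph.{u} a b) : Prop :=
  ∀ x y, G.DiagonalEdge x y → |((x.1 : ℕ) : ℤ) - ((y.1 : ℕ) : ℤ)| = 1

/-- Every diagonal edge joins adjacent columns. -/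
def ColumnStratified {a b : ℕ} (G : GridLabelledGraph.{u} a b) : Prop :=
  ∀ x y, G.DiagonalEdge x y → |((x.2 : ℕ) : ℤ) - ((y.2 : ℕ) : ℤ)| = 1

end GridLabelledGraph

/-! Separable implies PPT because partial transposition sends `A ⊗ B` to `Aᵀ ⊗ B`. PPT implies the
degree criterion by testing on the all-ones vector (`degreeCriterion_of_posSemidef`): the quadratic
form there is the sum of all entries of `L(G)`, hence zero, so positivity forces the row sums of the
partial transpose to vanish, and these are the degree differences between `G` and `Γ(G)`.

The substance is the return from the degree criterion to separability. Fix rows `i`, `k` and let `N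
j l` be the weight of the edge from `(i, j)` to `(k, l)`. For fixed `j`, the `j`-th row sum of `N`
minus its `j`-th column sum is antisymmetric in `(i, k)`; it is tridiagonal by row stratification,
and its row sums vanish by the degree criterion. So it is zero (`eq_zero_of_antisymm_tridiagonal`),
and each pair of rows is balanced separately. By Birkhoff's theorem a balanced `N` is, off the
diagonal, a nonnegative combination of permutations `σ`. The edges from `(i, j)` to `(k, σ j)` along
an orbit of `σ` form a cyclic family, and a discrete Fourier transform turns their edge vectors into
product vectors (`sum_edgeMatrix_orbit_mem_sepCone`). Column stratification follows by interchanging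
the factors. -/

open Matrix Finset

/-! ### The cone of unnormalised separable matrices -/

/-- The convex cone of unnormalised separable matrices: the finite sums of Kronecker products of
positive semidefinite matrices. -/
def sepCone (a b : ℕ) : AddSubmonoid (Matrix (Fin a × Fin b) (Fin a × Fin b) ℂ) :=
  AddSubmonoid.closure {M | ∃ (A : Matrix (Fin a) (Fin a) ℂ) (B : Matrix (Fin b) (Fin b) ℂ),
    A.PosSemidef ∧ B.PosSemidef ∧ M = A ⊗ₖ B}

lemma kronecker_mem_sepCone {a b : ℕ} {A : Matrix (Fin a) (Fin a) ℂ}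
    {B : Matrix (Fin b) (Fin b) ℂ} (hA : A.PosSemidef) (hB : B.PosSemidef) :
    A ⊗ₖ B ∈ sepCone a b :=
  AddSubmonoid.subset_closure ⟨A, B, hA, hB, rfl⟩

lemma smul_mem_sepCone {a b : ℕ} {M : Matrix (Fin a × Fin b) (Fin a × Fin b) ℂ}
    (hM : M ∈ sepCone a b) {c : ℝ} (hc : 0 ≤ c) : (c : ℂ) • M ∈ sepCone a b := by
  induction hM using AddSubmonoid.closure_induction with
  | mem M h =>
    obtain ⟨A, B, hA, hB, rfl⟩ := h
    rw [← smul_kronecker]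
    exact kronecker_mem_sepCone (hA.smul (by exact_mod_cast hc)) hB
  | zero => rw [smul_zero]; exact zero_mem _
  | add x y _ _ hx hy => rw [smul_add]; exact add_mem hx hy

/-- Interchanging the two tensor factors preserves the separable cone. -/
lemma submatrix_swap_mem_sepCone {a b : ℕ} {M : Matrix (Fin a × Fin b) (Fin a × Fin b) ℂ}
    (hM : M ∈ sepCone a b) : M.submatrix Prod.swap Prod.swap ∈ sepCone b a := by
  induction hM using AddSubmonoid.closure_induction with
  | mem M h =>
    obtain ⟨A, B, hA, hB, rfl⟩ := h
    convert kronecker_mem_sepCone hB hA using 1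
    ext x y
    simp [mul_comm]
  | zero => exact zero_mem _
  | add x y _ _ hx hy => exact add_mem hx hy

lemma partialTransposeA_posSemidef_of_mem_sepCone {a b : ℕ}
    {M : Matrix (Fin a × Fin b) (Fin a × Fin b) ℂ} (hM : M ∈ sepCone a b) :
    (partialTransposeA M).PosSemidef := by
  induction hM using AddSubmonoid.closure_induction with
  | mem M h =>
    obtain ⟨A, B, hA, hB, rfl⟩ := h
    have h : partialTransposeA (A ⊗ₖ B) = Aᵀ ⊗ₖ B := rfl
    rw [h]
    exact hA.transpose.kronecker hB
  | zero => exact PosSemidef.zero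
  | add x y _ _ hx hy => exact hx.add hy

lemma Matrix.PosSemidef.exists_smul_isDensityMatrix {n : Type*} [Fintype n]
    {A : Matrix n n ℂ} (hA : A.PosSemidef) (h0 : A ≠ 0) :
    ∃ (t : ℝ) (ρ : Matrix n n ℂ), 0 ≤ t ∧ IsDensityMatrix ρ ∧ A = (t : ℂ) • ρ := by
  have htr : A.trace ≠ 0 := fun h => h0 (hA.trace_eq_zero_iff.1 h)
  obtain ⟨t, ht, htA⟩ := RCLike.nonneg_iff_exists_ofReal.1 hA.trace_nonneg
  have htA' : (t : ℂ) = A.trace := htA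
  have ht0 : (t : ℂ) ≠ 0 := htA' ▸ htr
  refine ⟨t, ((t⁻¹ : ℝ) : ℂ) • A, ht, ⟨hA.smul (by exact_mod_cast inv_nonneg.2 ht), ?_⟩, ?_⟩
  · rw [trace_smul, ← htA', smul_eq_mul, Complex.ofReal_inv, inv_mul_cancel₀ ht0]
  · rw [smul_smul, Complex.ofReal_inv, mul_inv_cancel₀ ht0, one_smul]

lemma exists_sum_of_mem_sepCone {a b : ℕ} {M : Matrix (Fin a × Fin b) (Fin a × Fin b) ℂ}
    (hM : M ∈ sepCone a b) :
    ∃ (k : ℕ) (p : Fin k → ℝ) (σ : Fin k → Matrix (Fin a) (Fin a) ℂ)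
      (τ : Fin k → Matrix (Fin b) (Fin b) ℂ),
      (∀ i, 0 ≤ p i) ∧ (∀ i, IsDensityMatrix (σ i)) ∧ (∀ i, IsDensityMatrix (τ i)) ∧
      M = ∑ i, (p i : ℂ) • (σ i ⊗ₖ τ i) := by
  induction hM using AddSubmonoid.closure_induction with
  | mem M h =>
    obtain ⟨A, B, hA, hB, rfl⟩ := h
    -- A zero factor cannot be normalised to trace one; the product is then the empty sum.
    by_cases hA0 : A = 0
    · exact ⟨0, Fin.elim0, Fin.elim0, Fin.elim0, nofun, nofun, nofun, by simp [hA0]⟩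
    by_cases hB0 : B = 0
    · exact ⟨0, Fin.elim0, Fin.elim0, Fin.elim0, nofun, nofun, nofun, by simp [hB0]⟩
    obtain ⟨s, ρ, hs, hρ, rfl⟩ := hA.exists_smul_isDensityMatrix hA0
    obtain ⟨t, τ, ht, hτ, rfl⟩ := hB.exists_smul_isDensityMatrix hB0
    refine ⟨1, fun _ => s * t, fun _ => ρ, fun _ => τ, fun _ => mul_nonneg hs ht, fun _ => hρ,
      fun _ => hτ, ?_⟩
    rw [Fin.sum_univ_one, smul_kronecker, kronecker_smul, smul_smul, Complex.ofReal_mul]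
  | zero => exact ⟨0, Fin.elim0, Fin.elim0, Fin.elim0, nofun, nofun, nofun, by simp⟩
  | add x y _ _ hx hy =>
    obtain ⟨k, p, σ, τ, hp, hσ, hτ, rfl⟩ := hx
    obtain ⟨k', p', σ', τ', hp', hσ', hτ', rfl⟩ := hy
    refine ⟨k + k', Fin.append p p', Fin.append σ σ', Fin.append τ τ', ?_, ?_, ?_, ?_⟩
    · exact fun i => Fin.addCases (by simpa using hp) (by simpa using hp') i
    · exact fun i => Fin.addCases (by simpa using hσ) (by simpa using hσ') i
    · exact fun i => Fin.addCases (by simpa using hτ) (by simpa using hτ') i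
    · simp [Fin.sum_univ_add]

/-- A matrix is a separable state if and only if it lies in the separable cone and has
trace one. -/
lemma isSeparableState_iff {a b : ℕ} {M : Matrix (Fin a × Fin b) (Fin a × Fin b) ℂ} :
    IsSeparableState M ↔ M ∈ sepCone a b ∧ M.trace = 1 := by
  constructor
  · rintro ⟨k, p, σ, τ, hp, hsum, hσ, hτ, rfl⟩
    refine ⟨sum_mem fun i _ => smul_mem_sepCone (kronecker_mem_sepCone (hσ i).1 (hτ i).1) (hp i), ?_⟩
    simp only [trace_sum, trace_smul, trace_kronecker, (hσ _).2, (hτ _).2, mul_one, smul_eq_mul]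
    exact_mod_cast hsum
  · rintro ⟨hM, htr⟩
    obtain ⟨k, p, σ, τ, hp, hσ, hτ, rfl⟩ := exists_sum_of_mem_sepCone hM
    refine ⟨k, p, σ, τ, hp, ?_, hσ, hτ, rfl⟩
    simp only [trace_sum, trace_smul, trace_kronecker, (hσ _).2, (hτ _).2, mul_one,
      smul_eq_mul] at htr
    exact_mod_cast htr

/-! ### Edge Laplacians and cyclic families of edges -/

/-- The Laplacian of the single edge `{x, y}`. -/
def edgeMatrix {n : Type*} [DecidableEq n] (x y : n) : Matrix n n ℂ :=
  vecMulVec (Pi.single x 1 - Pi.single y 1) (star (Pi.single x 1 - Pi.single y 1))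

lemma edgeMatrix_apply {n : Type*} [DecidableEq n] (x y p q : n) :
    edgeMatrix x y p q = ((if p = x then 1 else 0) - (if p = y then 1 else 0)) *
      ((if q = x then 1 else 0) - (if q = y then 1 else 0)) := by
  simp only [edgeMatrix, vecMulVec_apply, Pi.star_apply, Pi.sub_apply, Pi.single_apply, star_sub]
  split_ifs <;> simp

lemma vecMulVec_product_mem_sepCone {a b : ℕ} (u : Fin a → ℂ) (v : Fin b → ℂ) :
    vecMulVec (fun x : Fin a × Fin b => u x.1 * v x.2)
      (star fun x : Fin a × Fin b => u x.1 * v x.2) ∈ sepCone a b := by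
  convert kronecker_mem_sepCone (posSemidef_vecMulVec_self_star u)
    (posSemidef_vecMulVec_self_star v) using 1
  ext x y
  simp [vecMulVec_apply]
  ring

/-- The edge vector is already a product, `(e_i - e_k) ⊗ e_j`. -/
lemma edgeMatrix_vertical_mem_sepCone {a b : ℕ} (i k : Fin a) (j : Fin b) :
    edgeMatrix (i, j) (k, j) ∈ sepCone a b := by
  convert vecMulVec_product_mem_sepCone (Pi.single i 1 - Pi.single k 1) (Pi.single j 1) using 1
  ext ⟨p, p'⟩ ⟨q, q'⟩
  simp only [edgeMatrix_apply, vecMulVec_apply, Pi.star_apply, Pi.sub_apply, Pi.single_apply,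
    Prod.mk.injEq]
  by_cases h1 : p' = j <;> by_cases h2 : q' = j <;> simp [h1, h2]

/-- Plancherel's identity for a family of vectors indexed by `ℤ/n`. -/
lemma sum_vecMulVec_fourier {m : Type*} {n : ℕ} [NeZero n] (g : ZMod n → m → ℂ) :
    ∑ κ : ZMod n, vecMulVec (∑ t, ZMod.stdAddChar (κ * t) • g t)
      (star (∑ t, ZMod.stdAddChar (κ * t) • g t)) = (n : ℂ) • ∑ t, vecMulVec (g t) (star (g t)) := by
  ext x y
  simp only [Matrix.sum_apply, vecMulVec_apply, Matrix.smul_apply, Finset.sum_apply, Pi.star_apply,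
    Pi.smul_apply, smul_eq_mul, star_sum, Finset.sum_mul_sum]
  rw [Finset.sum_comm, Finset.mul_sum]
  refine Finset.sum_congr rfl fun t _ => ?_
  rw [Finset.sum_comm]
  have key : ∀ s : ZMod n, ∑ κ : ZMod n, ZMod.stdAddChar (κ * t) * g t x *
      star (ZMod.stdAddChar (κ * s) * g s y) =
      (if t - s = 0 then (n : ℂ) else 0) * (g t x * star (g s y)) := by
    intro s
    -- Orthogonality of characters kills the cross terms with `s ≠ t`.
    have h := AddChar.sum_mulShift (t - s) (ZMod.isPrimitive_stdAddChar n)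
    rw [ZMod.card] at h
    push_cast at h
    rw [← h, Finset.sum_mul]
    refine Finset.sum_congr rfl fun κ _ => ?_
    rw [star_mul', mul_sub, sub_eq_add_neg, AddChar.map_add_eq_mul, AddChar.map_neg_eq_conj]
    simp only [starRingEnd_apply]
    ring
  rw [Finset.sum_congr rfl fun s _ => key s]
  simp [sub_eq_zero]

/-- By Plancherel the edge vectors `g t` may be replaced by their Fourier transforms, up to the
factor `n`. Since the second endpoint of `g t` is the first one advanced by one step, the transform
at `κ` factors as `(e_i - χ(-κ) e_k) ⊗ ∑ t, χ(κ t) e_{σ^t j}`. -/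
lemma sum_edgeMatrix_orbit_mem_sepCone {a b : ℕ} (σ : Equiv.Perm (Fin b)) (i k : Fin a)
    (j : Fin b) {n : ℕ} [NeZero n] (hn : σ ^ n = 1) :
    ∑ t : ZMod n, edgeMatrix (i, (σ ^ t.val) j) (k, σ ((σ ^ t.val) j)) ∈ sepCone a b := by
  have hsucc : ∀ t : ZMod n, σ ((σ ^ t.val) j) = (σ ^ (t + 1).val) j := by
    intro t
    rw [← Equiv.Perm.mul_apply, ← pow_succ', ZMod.val_add, ZMod.val_one_eq_one_mod,
      Nat.add_mod_mod, ← pow_eq_pow_mod _ hn]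
  let g : ZMod n → Fin a × Fin b → ℂ := fun t =>
    Pi.single (i, (σ ^ t.val) j) 1 - Pi.single (k, σ ((σ ^ t.val) j)) 1
  have hn0 : (n : ℂ) ≠ 0 := NeZero.ne _
  have h := sum_vecMulVec_fourier g
  have h2 : ∑ t : ZMod n, edgeMatrix (i, (σ ^ t.val) j) (k, σ ((σ ^ t.val) j)) =
      (((n : ℝ)⁻¹ : ℝ) : ℂ) • ∑ κ : ZMod n, vecMulVec (∑ t, ZMod.stdAddChar (κ * t) • g t)
      (star (∑ t, ZMod.stdAddChar (κ * t) • g t)) := by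
    rw [h, smul_smul]
    push_cast
    rw [inv_mul_cancel₀ hn0, one_smul]
    rfl
  rw [h2]
  refine smul_mem_sepCone (sum_mem fun κ _ => ?_) (by positivity)
  convert vecMulVec_product_mem_sepCone
    (Pi.single i 1 - (ZMod.stdAddChar (-κ) : ℂ) • Pi.single k 1)
    (∑ t : ZMod n, (ZMod.stdAddChar (κ * t) : ℂ) • Pi.single ((σ ^ t.val) j) 1) using 1
  have hg : (∑ t, ZMod.stdAddChar (κ * t) • g t) = fun x : Fin a × Fin b =>
      (Pi.single i 1 - (ZMod.stdAddChar (-κ) : ℂ) • Pi.single k 1 : Fin a → ℂ) x.1 *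
      (∑ t : ZMod n, (ZMod.stdAddChar (κ * t) : ℂ) • Pi.single ((σ ^ t.val) j) 1 : Fin b → ℂ) x.2 := by
    -- Advancing `t` by one only costs the phase `χ(-κ)`.
    have hshift : ∑ t : ZMod n, (ZMod.stdAddChar (κ * t) : ℂ) •
        (Pi.single (k, (σ ^ (t + 1).val) j) 1 : Fin a × Fin b → ℂ) =
        (ZMod.stdAddChar (-κ) : ℂ) • ∑ t : ZMod n, (ZMod.stdAddChar (κ * t) : ℂ) •
        (Pi.single (k, (σ ^ t.val) j) 1 : Fin a × Fin b → ℂ) := by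
      rw [Finset.smul_sum, ← Equiv.sum_comp (Equiv.addRight (1 : ZMod n)) (fun t =>
        (ZMod.stdAddChar (-κ) : ℂ) • (ZMod.stdAddChar (κ * t) : ℂ) •
        (Pi.single (k, (σ ^ t.val) j) 1 : Fin a × Fin b → ℂ))]
      refine Finset.sum_congr rfl fun t _ => ?_
      rw [smul_smul, ← AddChar.map_add_eq_mul, Equiv.coe_addRight]
      ring_nf
    simp only [g, smul_sub, Finset.sum_sub_distrib, hsucc]
    rw [hshift]
    ext ⟨p, p'⟩
    simp only [Pi.sub_apply, Pi.smul_apply, Finset.sum_apply, Pi.single_apply, smul_eq_mul,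
      Prod.mk.injEq]
    have hi : ∀ (P Q : Prop) [Decidable P] [Decidable Q],
        (if P ∧ Q then (1 : ℂ) else 0) = (if P then 1 else 0) * if Q then 1 else 0 := by
      intro P Q _ _
      split_ifs <;> simp_all
    simp only [hi, sub_mul, Finset.mul_sum]
    rw [← Finset.sum_sub_distrib]
    exact Finset.sum_congr rfl fun t _ => by ring
  rw [hg]

lemma sum_edgeMatrix_perm_mem_sepCone {a b : ℕ} (σ : Equiv.Perm (Fin b)) (i k : Fin a) :
    ∑ j with σ j ≠ j, edgeMatrix (i, j) (k, σ j) ∈ sepCone a b := by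
  have : NeZero (orderOf σ) := ⟨(orderOf_pos σ).ne'⟩
  have hn0 : (orderOf σ : ℂ) ≠ 0 := NeZero.ne _
  -- No cycle decomposition is needed: `σ ^ t` permutes the points moved by `σ`, so summing over `t`
  -- and then over `j` counts every edge `orderOf σ` times.
  have h : ∑ j with σ j ≠ j, edgeMatrix (i, j) (k, σ j) = (((orderOf σ : ℝ)⁻¹ : ℝ) : ℂ) •
      ∑ j with σ j ≠ j, ∑ t : ZMod (orderOf σ),
        edgeMatrix (i, (σ ^ t.val) j) (k, σ ((σ ^ t.val) j)) := by
    rw [Finset.sum_comm]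
    have hperm : ∀ t : ZMod (orderOf σ), ∑ j with σ j ≠ j,
        edgeMatrix (i, (σ ^ t.val) j) (k, σ ((σ ^ t.val) j)) =
        ∑ j with σ j ≠ j, edgeMatrix (i, j) (k, σ j) := by
      intro t
      rw [Finset.sum_filter, Finset.sum_filter,
        ← Equiv.sum_comp (σ ^ t.val) (fun j => if σ j ≠ j then edgeMatrix (i, j) (k, σ j) else 0)]
      refine Finset.sum_congr rfl fun j _ => ?_
      have : σ ((σ ^ t.val) j) = (σ ^ t.val) (σ j) := by
        rw [← Equiv.Perm.mul_apply, ← Equiv.Perm.mul_apply, (Commute.self_pow σ _).eq]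
      have h2 : σ ((σ ^ t.val) j) ≠ (σ ^ t.val) j ↔ σ j ≠ j := by
        rw [this, (σ ^ t.val).injective.ne_iff]
      simp only [h2]
    rw [Finset.sum_congr rfl fun t _ => hperm t, Finset.sum_const, Finset.card_univ, ZMod.card,
      ← Nat.cast_smul_eq_nsmul ℂ, smul_smul]
    push_cast
    rw [inv_mul_cancel₀ hn0, one_smul]
  rw [h]
  exact smul_mem_sepCone (sum_mem fun j _ => sum_edgeMatrix_orbit_mem_sepCone σ i k j
    (pow_orderOf_eq_one σ)) (by positivity)

/-! ### Balanced weights and Birkhoff's theorem -/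

/-- Every nonnegative matrix whose row sums equal its column sums has, off the diagonal, the
entries of a nonnegative combination of permutation matrices. -/
lemma exists_perm_weights_of_balanced {n : Type*} [Fintype n] [DecidableEq n] (N : n → n → ℝ)
    (h0 : ∀ j l, 0 ≤ N j l) (hN : ∀ j, ∑ l, N j l = ∑ l, N l j) :
    ∃ w : Equiv.Perm n → ℝ, (∀ σ, 0 ≤ w σ) ∧
      ∀ j l, j ≠ l → N j l = ∑ σ : Equiv.Perm n, if σ j = l then w σ else 0 := by
  -- `K` bounds every row sum, and the summand `1` keeps it positive when `N` vanishes.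
  set K : ℝ := 1 + ∑ j, ∑ l, N j l with hK
  have hrow : ∀ j, ∑ l, N j l ≤ K := fun j => by
    have := Finset.single_le_sum (f := fun j => ∑ l, N j l)
      (fun j _ => Finset.sum_nonneg fun l _ => h0 j l) (Finset.mem_univ j)
    linarith
  have hK0 : 0 < K := by
    have : 0 ≤ ∑ j, ∑ l, N j l := Finset.sum_nonneg fun j _ => Finset.sum_nonneg fun l _ => h0 j l
    linarith
  -- Padding the diagonal brings every row and column sum to `K`; only the off-diagonal entries of
  -- `N` survive, which is why the conclusion needs `j ≠ l`.
  let M : Matrix n n ℝ := K⁻¹ • (Matrix.of N + diagonal fun j => K - ∑ l, N j l)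
  have hM : M ∈ doublyStochastic ℝ n := by
    rw [mem_doublyStochastic_iff_sum]
    refine ⟨fun j l => ?_, fun j => ?_, fun j => ?_⟩
    · refine mul_nonneg (inv_nonneg.2 hK0.le) (add_nonneg (h0 j l) ?_)
      rw [diagonal_apply]
      split_ifs
      · linarith [hrow j]
      · exact le_rfl
    · simp only [M, Matrix.smul_apply, Matrix.add_apply, Matrix.of_apply, diagonal_apply,
        smul_eq_mul, ← Finset.mul_sum, Finset.sum_add_distrib, Finset.sum_ite_eq,
        Finset.mem_univ, if_true]
      field_simp
      ring
    · simp only [M, Matrix.smul_apply, Matrix.add_apply, Matrix.of_apply, diagonal_apply,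
        smul_eq_mul, ← Finset.mul_sum, Finset.sum_add_distrib, Finset.sum_ite_eq',
        Finset.mem_univ, if_true, hN]
      field_simp
      ring
  obtain ⟨w, hw0, -, hw⟩ := exists_eq_sum_perm_of_mem_doublyStochastic hM
  refine ⟨fun σ => K * w σ, fun σ => mul_nonneg hK0.le (hw0 σ), fun j l hjl => ?_⟩
  have h := congrFun (congrFun hw j) l
  simp only [Matrix.sum_apply, Matrix.smul_apply, Equiv.Perm.permMatrix, PEquiv.toMatrix_apply,
    Equiv.toPEquiv_apply, Option.mem_def, Option.some.injEq, smul_eq_mul, M, Matrix.add_apply,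
    Matrix.of_apply, diagonal_apply_ne _ hjl, add_zero, mul_ite, mul_one, mul_zero] at h
  simp only [← mul_ite_zero, ← Finset.mul_sum]
  rw [h, mul_inv_cancel_left₀ hK0.ne']

lemma sum_edgeMatrix_balanced_mem_sepCone {a b : ℕ} (N : Fin b → Fin b → ℝ)
    (h0 : ∀ j l, 0 ≤ N j l) (hN : ∀ j, ∑ l, N j l = ∑ l, N l j) (i k : Fin a) :
    ∑ j, ∑ l, (N j l : ℂ) • edgeMatrix (i, j) (k, l) ∈ sepCone a b := by
  obtain ⟨w, hw0, hw⟩ := exists_perm_weights_of_balanced N h0 hN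
  -- The entries with `j = l` are split off as vertical edges, and fixed points of the permutations,
  -- an artefact of the padding, are discarded.
  have h : ∑ j, ∑ l, (N j l : ℂ) • edgeMatrix (i, j) (k, l) =
      ∑ j, (N j j : ℂ) • edgeMatrix (i, j) (k, j) +
      ∑ σ : Equiv.Perm (Fin b), (w σ : ℂ) • ∑ j with σ j ≠ j, edgeMatrix (i, j) (k, σ j) := by
    simp only [Finset.smul_sum, Finset.sum_filter]
    rw [Finset.sum_comm (s := (univ : Finset (Equiv.Perm (Fin b)))), ← Finset.sum_add_distrib]
    refine Finset.sum_congr rfl fun j _ => ?_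
    rw [← Finset.add_sum_erase _ _ (Finset.mem_univ j)]
    congr 1
    have : ∀ σ : Equiv.Perm (Fin b),
        (w σ : ℂ) • (if σ j ≠ j then edgeMatrix (i, j) (k, σ j) else 0) =
        ∑ l ∈ univ.erase j, ((if σ j = l then w σ else 0 : ℝ) : ℂ) • edgeMatrix (i, j) (k, l) := by
      intro σ
      have : ∀ l, ((if σ j = l then w σ else 0 : ℝ) : ℂ) • edgeMatrix (i, j) (k, l) =
        if σ j = l then (w σ : ℂ) • edgeMatrix (i, j) (k, l) else 0 := by
        intro l
        split_ifs <;> simp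
      simp only [this, Finset.sum_ite_eq, Finset.mem_erase, Finset.mem_univ, and_true]
      split_ifs <;> simp
    rw [Finset.sum_congr rfl fun σ _ => this σ, Finset.sum_comm]
    refine Finset.sum_congr rfl fun l hl => ?_
    rw [← Finset.sum_smul, hw j l (Finset.ne_of_mem_erase hl).symm]
    push_cast
    rfl
  rw [h]
  refine add_mem (sum_mem fun j _ => smul_mem_sepCone (edgeMatrix_vertical_mem_sepCone i k j)
    (h0 j j)) (sum_mem fun σ _ => smul_mem_sepCone (sum_edgeMatrix_perm_mem_sepCone σ i k) (hw0 σ))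

/-! ### Separability of stratified weights -/

/-- An antisymmetric tridiagonal matrix with vanishing row sums is zero. -/
lemma eq_zero_of_antisymm_tridiagonal {a : ℕ} (f : Fin a → Fin a → ℝ)
    (hanti : ∀ i k, f i k = -f k i) (hsum : ∀ i, ∑ k, f i k = 0)
    (htri : ∀ i k : Fin a, |((i : ℕ) : ℤ) - ((k : ℕ) : ℤ)| ≠ 1 → f i k = 0) (i k : Fin a) :
    f i k = 0 := by
  -- Induction along the superdiagonal: the subdiagonal entry of row `i` vanishes by the previous
  -- step and antisymmetry, so the superdiagonal entry equals the whole row sum.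
  have hup : ∀ n : ℕ, ∀ i k : Fin a, (i : ℕ) = n → (k : ℕ) = n + 1 → f i k = 0 := by
    intro n
    induction n using Nat.strong_induction_on with
    | _ n ih =>
      intro i k hi hk
      rw [← hsum i]
      refine (Finset.sum_eq_single k (fun l _ hl => ?_) (by simp)).symm
      by_cases h : |((i : ℕ) : ℤ) - ((l : ℕ) : ℤ)| = 1
      · have hne : (l : ℕ) ≠ k := fun h => hl (Fin.ext h)
        have : (l : ℕ) + 1 = i := by
          rcases (abs_eq one_pos.le).1 h with h | h <;> omega
        rw [hanti, ih l (by omega) l i rfl (by omega), neg_zero]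
      · exact htri _ _ h
  by_cases h : |((i : ℕ) : ℤ) - ((k : ℕ) : ℤ)| = 1
  · rcases (abs_eq one_pos.le).1 h with h | h
    · rw [hanti, hup k k i rfl (by omega), neg_zero]
    · exact hup i i k rfl (by omega)
  · exact htri _ _ h

lemma sum_edgeMatrix_mem_sepCone_of_rowStratified {a b : ℕ}
    (w : Fin a × Fin b → Fin a × Fin b → ℝ) (h0 : ∀ x y, 0 ≤ w x y)
    (hsymm : ∀ x y, w x y = w y x)
    (hdeg : ∀ x, ∑ y, w x y = ∑ y : Fin a × Fin b, w (y.1, x.2) (x.1, y.2))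
    (hrow : ∀ x y, w x y ≠ 0 → x.1 ≠ y.1 → x.2 ≠ y.2 →
      |((x.1 : ℕ) : ℤ) - ((y.1 : ℕ) : ℤ)| = 1) :
    ∑ x, ∑ y, (w x y : ℂ) • edgeMatrix x y ∈ sepCone a b := by
  -- The degree hypothesis balances only the sum over all `k`; stratification makes each pair of
  -- rows balance.
  have hbal : ∀ (j : Fin b) (i k : Fin a),
      ∑ l, (w (i, j) (k, l) - w (k, j) (i, l)) = 0 := by
    intro j i k
    refine eq_zero_of_antisymm_tridiagonal
      (fun i k => ∑ l, (w (i, j) (k, l) - w (k, j) (i, l))) (fun i k => ?_) (fun i => ?_)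
      (fun i k hik => Finset.sum_eq_zero fun l _ => ?_) i k
    · rw [← Finset.sum_neg_distrib]
      exact Finset.sum_congr rfl fun l _ => by ring
    · have := hdeg (i, j)
      simp only [Fintype.sum_prod_type] at this
      simp only [Finset.sum_sub_distrib]
      rw [this, sub_self]
    · by_cases h1 : i = k
      · subst h1; rw [sub_self]
      by_cases h2 : j = l
      · subst h2; rw [hsymm, sub_self]
      have e1 : w (i, j) (k, l) = 0 := by
        by_contra h
        exact hik (hrow _ _ h h1 h2)
      have e2 : w (k, j) (i, l) = 0 := by
        by_contra h
        exact hik (by rw [abs_sub_comm]; exact hrow _ _ h (Ne.symm h1) h2)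
      rw [e1, e2, sub_self]
  have hsplit : ∑ x, ∑ y, (w x y : ℂ) • edgeMatrix x y =
      ∑ i, ∑ k, ∑ j, ∑ l, (w (i, j) (k, l) : ℂ) • edgeMatrix (i, j) (k, l) := by
    simp only [Fintype.sum_prod_type]
    exact Finset.sum_congr rfl fun i _ => Finset.sum_comm
  rw [hsplit]
  refine sum_mem fun i _ => sum_mem fun k _ => sum_edgeMatrix_balanced_mem_sepCone _
    (fun j l => h0 _ _) (fun j => ?_) i k
  have h := hbal j i k
  rw [Finset.sum_sub_distrib, sub_eq_zero] at h
  rw [h]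
  exact Finset.sum_congr rfl fun l _ => hsymm _ _

lemma edgeMatrix_submatrix_equiv {m n : Type*} [DecidableEq m] [DecidableEq n] (e : m ≃ n)
    (x y : m) : (edgeMatrix (e x) (e y)).submatrix e e = edgeMatrix x y := by
  ext p q
  simp [edgeMatrix_apply]

lemma sum_edgeMatrix_mem_sepCone_of_columnStratified {a b : ℕ}
    (w : Fin a × Fin b → Fin a × Fin b → ℝ) (h0 : ∀ x y, 0 ≤ w x y)
    (hsymm : ∀ x y, w x y = w y x)
    (hdeg : ∀ x, ∑ y, w x y = ∑ y : Fin a × Fin b, w (y.1, x.2) (x.1, y.2))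
    (hcol : ∀ x y, w x y ≠ 0 → x.1 ≠ y.1 → x.2 ≠ y.2 →
      |((x.2 : ℕ) : ℤ) - ((y.2 : ℕ) : ℤ)| = 1) :
    ∑ x, ∑ y, (w x y : ℂ) • edgeMatrix x y ∈ sepCone a b := by
  have h := sum_edgeMatrix_mem_sepCone_of_rowStratified
    (fun x y : Fin b × Fin a => w x.swap y.swap) (fun x y => h0 _ _) (fun x y => hsymm _ _)
    (fun x => ?_) (fun x y h h1 h2 => hcol _ _ h h2 h1)
  · convert submatrix_swap_mem_sepCone h using 1
    ext p q
    simp only [Matrix.sum_apply, Matrix.submatrix_apply, Matrix.smul_apply]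
    rw [← (Equiv.prodComm (Fin b) (Fin a)).sum_comp]
    refine Finset.sum_congr rfl fun x _ => ?_
    rw [← (Equiv.prodComm (Fin b) (Fin a)).sum_comp]
    refine Finset.sum_congr rfl fun y _ => ?_
    have := congrFun (congrFun (edgeMatrix_submatrix_equiv
      (Equiv.prodComm (Fin b) (Fin a)) x y) p.swap) q.swap
    rw [← this]
    rfl
  · refine ((Equiv.prodComm (Fin b) (Fin a)).sum_comp (fun y => w x.swap y)).trans ?_
    rw [hdeg, ← (Equiv.prodComm (Fin b) (Fin a)).sum_comp]
    exact Finset.sum_congr rfl fun y _ => hsymm _ _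

/-! ### Laplacians, partial transposes and the degree criterion -/

lemma partialTransposeB_eq_partialTransposeA_of_isSymm {a b : ℕ}
    {M : Matrix (Fin a × Fin b) (Fin a × Fin b) ℂ} (hM : M.IsSymm) :
    partialTransposeB M = partialTransposeA M := by
  ext x y
  exact hM.apply _ _

/-- The factor `2` arises because the sum runs over ordered pairs and meets each edge twice. -/
lemma SimpleGraph.two_smul_lapMatrix_eq_sum {n : Type*} [Fintype n] [DecidableEq n]
    (H : SimpleGraph n) [DecidableRel H.Adj] : (2 : ℂ) • H.lapMatrix ℂ =
      ∑ x, ∑ y, ((if H.Adj x y then 1 else 0 : ℝ) : ℂ) • edgeMatrix x y := by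
  ext p q
  let c : n → n → ℂ := fun x y => if H.Adj x y then 1 else 0
  have hcsymm : ∀ x y, c x y = c y x := fun x y => by simp only [c, H.adj_comm]
  have hcast : ∀ x y, ((if H.Adj x y then 1 else 0 : ℝ) : ℂ) = c x y := fun x y => by
    simp only [c]; split_ifs <;> simp
  have hterm : ∀ x y, c x y * edgeMatrix x y p q =
      (if x = p then (if p = q then c p y else 0) else 0) -
      (if x = p then (if y = q then c p q else 0) else 0) -
      (if x = q then (if y = p then c q p else 0) else 0) +
      (if y = p then (if p = q then c x p else 0) else 0) := by
    intro x y
    rw [edgeMatrix_apply]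
    simp only [@eq_comm _ p x, @eq_comm _ p y, @eq_comm _ q x, @eq_comm _ q y]
    by_cases h1 : x = p <;> by_cases h2 : y = p <;> by_cases h3 : x = q <;> by_cases h4 : y = q <;>
      subst_vars <;> simp_all
  simp only [Matrix.sum_apply, Matrix.smul_apply, smul_eq_mul, hcast, hterm,
    Finset.sum_add_distrib, Finset.sum_sub_distrib, Finset.sum_ite_irrel, Finset.sum_const_zero,
    Finset.sum_ite_eq', Finset.mem_univ, if_true]
  simp only [SimpleGraph.lapMatrix, SimpleGraph.degMatrix, Matrix.sub_apply,
    SimpleGraph.adjMatrix_apply, diagonal_apply, H.degree_eq_sum_if_adj (R := ℂ)]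
  rw [hcsymm q p, Finset.sum_congr rfl fun x _ => hcsymm x p]
  split_ifs <;> simp only [c] <;> simp_all <;> ring

namespace GridLabelledGraph

variable {a b : ℕ} (G : GridLabelledGraph.{u} a b)

lemma onGrid_adj (x y : Fin a × Fin b) :
    G.onGrid.Adj x y ↔ G.graph.Adj (G.label.symm x) (G.label.symm y) := by
  rw [onGrid, SimpleGraph.map_adj]
  constructor
  · rintro ⟨u, v, h, rfl, rfl⟩
    simpa using h
  · exact fun h => ⟨_, _, h, by simp, by simp⟩

lemma partialTranspose_onGrid_adj (x y : Fin a × Fin b) :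
    G.partialTranspose.onGrid.Adj x y ↔ G.onGrid.Adj (y.1, x.2) (x.1, y.2) := by
  rw [onGrid_adj]
  change G.onGrid.Adj ((G.label (G.label.symm y)).1, (G.label (G.label.symm x)).2)
    ((G.label (G.label.symm x)).1, (G.label (G.label.symm y)).2) ↔ _
  simp only [Equiv.apply_symm_apply]

open Classical in
lemma degreeCriterion_iff : G.DegreeCriterion ↔
    ∀ x, G.onGrid.degree x = G.partialTranspose.onGrid.degree x := by
  rw [DegreeCriterion, degreeMatrix, degreeMatrix, SimpleGraph.degMatrix, SimpleGraph.degMatrix,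
    Matrix.diagonal_injective.eq_iff, funext_iff]
  exact forall_congr' fun x => Nat.cast_inj

open Classical in
lemma trace_laplacian : G.laplacian.trace = 2 * (G.edgeCount : ℂ) := by
  have h : G.laplacian.trace = ∑ x, (G.onGrid.degree x : ℂ) := by
    refine Finset.sum_congr rfl fun x _ => ?_
    simp [laplacian, SimpleGraph.lapMatrix, SimpleGraph.degMatrix]
  rw [h, edgeCount]
  exact_mod_cast G.onGrid.sum_degrees_eq_twice_card_edges

lemma densityMatrix_eq_smul :
    G.densityMatrix = (((2 * (G.edgeCount : ℝ))⁻¹ : ℝ) : ℂ) • G.laplacian := by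
  simp [densityMatrix]

lemma isSymm_densityMatrix : G.densityMatrix.IsSymm := by
  classical
  have h : G.laplacian.IsSymm := SimpleGraph.isSymm_lapMatrix _ _
  rw [densityMatrix]
  exact h.smul _

variable {G}

lemma trace_densityMatrix (hG : 0 < G.edgeCount) : G.densityMatrix.trace = 1 := by
  rw [densityMatrix, trace_smul, trace_laplacian, smul_eq_mul, one_div]
  have : (G.edgeCount : ℂ) ≠ 0 := by exact_mod_cast hG.ne'
  exact inv_mul_cancel₀ (by simpa using this)

open Classical in
lemma degreeCriterion_of_posSemidef (hG : 0 < G.edgeCount)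
    (h : (partialTransposeA G.densityMatrix).PosSemidef) : G.DegreeCriterion := by
  have hm : (0 : ℂ) ≤ 2 * (G.edgeCount : ℂ) := by positivity
  have hm0 : 2 * (G.edgeCount : ℂ) ≠ 0 := by
    have : (G.edgeCount : ℂ) ≠ 0 := by exact_mod_cast hG.ne'
    simpa using this
  have hL : (partialTransposeA G.laplacian).PosSemidef := by
    have e : partialTransposeA G.laplacian =
        (2 * (G.edgeCount : ℂ)) • partialTransposeA G.densityMatrix := by
      ext x y
      simp only [partialTransposeA, densityMatrix, Matrix.of_apply, Matrix.smul_apply, smul_eq_mul]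
      rw [one_div, mul_inv_cancel_left₀ hm0]
    rw [e]
    exact h.smul hm
  -- Partial transposition fixes diagonal matrices and turns the adjacency matrix of `G` into that
  -- of `Γ(G)`.
  have happ : ∀ x y, partialTransposeA G.laplacian x y =
      (G.degreeMatrix - G.partialTranspose.onGrid.adjMatrix ℂ) x y := by
    rintro ⟨i, j⟩ ⟨k, l⟩
    simp only [partialTransposeA, laplacian, SimpleGraph.lapMatrix, degreeMatrix,
      SimpleGraph.degMatrix, Matrix.of_apply, Matrix.sub_apply, SimpleGraph.adjMatrix_apply,
      partialTranspose_onGrid_adj, diagonal_apply, Prod.ext_iff]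
    by_cases h1 : i = k
    · subst h1; simp
    · simp [h1, Ne.symm h1]
  have hmul : ∀ x, (partialTransposeA G.laplacian *ᵥ 1) x =
      (G.onGrid.degree x : ℂ) - G.partialTranspose.onGrid.degree x := by
    intro x
    rw [Matrix.ext happ, Matrix.sub_mulVec, Pi.sub_apply, degreeMatrix,
      SimpleGraph.degMatrix_mulVec_apply, SimpleGraph.adjMatrix_mulVec_apply]
    simp
  have hzero : partialTransposeA G.laplacian *ᵥ 1 = 0 := by
    -- For a positive semidefinite matrix, a zero of the quadratic form is a kernel vector.
    rw [← hL.dotProduct_mulVec_zero_iff]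
    have e : star (1 : Fin a × Fin b → ℂ) ⬝ᵥ (partialTransposeA G.laplacian *ᵥ 1) =
        ∑ x : Fin a × Fin b, ∑ y : Fin a × Fin b, G.laplacian (y.1, x.2) (x.1, y.2) := by
      simp [dotProduct, mulVec, partialTransposeA]
    -- Partial transposition permutes the entries, so their total is unchanged.
    have e2 : ∑ x : Fin a × Fin b, ∑ y : Fin a × Fin b, G.laplacian (y.1, x.2) (x.1, y.2) =
        ∑ x : Fin a × Fin b, ∑ y : Fin a × Fin b, G.laplacian x y := by
      simp only [Fintype.sum_prod_type]
      rw [Finset.sum_congr rfl fun i _ => Finset.sum_comm, Finset.sum_comm]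
      exact Finset.sum_congr rfl fun i _ => Finset.sum_comm
    rw [e, e2]
    refine Finset.sum_eq_zero fun x _ => ?_
    have := congrFun (SimpleGraph.lapMatrix_mulVec_const_eq_zero (R := ℂ) G.onGrid) x
    simpa [mulVec, dotProduct, laplacian] using this
  rw [degreeCriterion_iff]
  intro x
  have := hmul x
  rw [hzero, Pi.zero_apply, eq_comm, sub_eq_zero] at this
  exact_mod_cast this

open Classical in
lemma laplacian_mem_sepCone (hS : G.RowStratified ∨ G.ColumnStratified) (hD : G.DegreeCriterion) :
    G.laplacian ∈ sepCone a b := by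
  have key : ∑ x, ∑ y, ((if G.onGrid.Adj x y then 1 else 0 : ℝ) : ℂ) • edgeMatrix x y ∈
      sepCone a b := by
    have h0 : ∀ x y, (0 : ℝ) ≤ if G.onGrid.Adj x y then 1 else 0 := by
      intro x y; split_ifs <;> norm_num
    have hsymm : ∀ x y, (if G.onGrid.Adj x y then 1 else 0 : ℝ) =
        if G.onGrid.Adj y x then 1 else 0 := fun x y => by simp only [G.onGrid.adj_comm]
    have hdeg : ∀ x, ∑ y, (if G.onGrid.Adj x y then 1 else 0 : ℝ) =
        ∑ y : Fin a × Fin b, if G.onGrid.Adj (y.1, x.2) (x.1, y.2) then 1 else 0 := by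
      intro x
      have := G.degreeCriterion_iff.1 hD x
      rw [← G.onGrid.degree_eq_sum_if_adj, this, SimpleGraph.degree_eq_sum_if_adj]
      simp only [partialTranspose_onGrid_adj]
    rcases hS with hS | hS
    · exact sum_edgeMatrix_mem_sepCone_of_rowStratified _ h0 hsymm hdeg fun x y h h1 h2 =>
        hS x y ⟨by simpa using h, h1, h2⟩
    · exact sum_edgeMatrix_mem_sepCone_of_columnStratified _ h0 hsymm hdeg fun x y h h1 h2 =>
        hS x y ⟨by simpa using h, h1, h2⟩
  rw [← SimpleGraph.two_smul_lapMatrix_eq_sum] at key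
  have h := smul_mem_sepCone key (c := 2⁻¹) (by norm_num)
  rw [smul_smul] at h
  norm_num at h
  exact h

lemma isSeparableState_densityMatrix (hG : 0 < G.edgeCount)
    (hS : G.RowStratified ∨ G.ColumnStratified) (hD : G.DegreeCriterion) :
    IsSeparableState G.densityMatrix := by
  refine isSeparableState_iff.2 ⟨?_, trace_densityMatrix hG⟩
  rw [densityMatrix_eq_smul]
  exact smul_mem_sepCone (laplacian_mem_sepCone hS hD) (by positivity)

lemma partialTransposeA_posSemidef (h : IsSeparableState G.densityMatrix) :
    (partialTransposeA G.densityMatrix).PosSemidef :=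
  partialTransposeA_posSemidef_of_mem_sepCone (isSeparableState_iff.1 h).1

lemma edgeCount_pos {x y : Fin a × Fin b} (h : G.onGrid.Adj x y) : 0 < G.edgeCount := by
  classical
  rw [edgeCount, Finset.card_pos]
  exact ⟨s(x, y), by simpa using h⟩

/-! ### A separable and an entangled example -/

/-- The grid-labelled graph whose vertices are the grid points themselves. -/
def ofGraph (H : SimpleGraph (Fin a × Fin b)) : GridLabelledGraph.{u} a b where
  V := ULift (Fin a × Fin b)
  graph := H.comap Equiv.ulift
  label := Equiv.ulift

lemma ofGraph_onGrid (H : SimpleGraph (Fin a × Fin b)) :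
    (ofGraph.{u} H).onGrid = H := by
  ext x y
  rw [onGrid_adj]
  exact Iff.rfl

/-- The grid graph whose only edges are the two diagonals of the corner square. -/
def crossGraph (a b : ℕ) : SimpleGraph (Fin (a + 2) × Fin (b + 2)) where
  Adj x y := (x.1 : ℕ) + y.1 = 1 ∧ (x.2 : ℕ) + y.2 = 1
  symm := ⟨fun x y h => by omega⟩
  loopless := ⟨fun x h => by omega⟩

/-- Partial transposition exchanges the two diagonals of the corner square, so the cross is its own
partial transpose. -/
lemma exists_stratified_separable (a b : ℕ) : ∃ G : GridLabelledGraph.{u} (a + 2) (b + 2),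
    G.RowStratified ∧ G.ColumnStratified ∧ (∃ x y, G.DiagonalEdge x y) ∧
      IsSeparableState G.densityMatrix := by
  have hrow : (ofGraph.{u} (crossGraph a b)).RowStratified := by
    rintro x y ⟨h, -, -⟩
    rw [ofGraph_onGrid] at h
    obtain ⟨h1, h2⟩ := h
    rw [abs_eq one_pos.le]
    omega
  have hcol : (ofGraph.{u} (crossGraph a b)).ColumnStratified := by
    rintro x y ⟨h, -, -⟩
    rw [ofGraph_onGrid] at h
    obtain ⟨h1, h2⟩ := h
    rw [abs_eq one_pos.le]
    omega
  have hadj : (ofGraph.{u} (crossGraph a b)).onGrid.Adj (0, 0) (1, 1) := by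
    rw [ofGraph_onGrid]
    exact ⟨rfl, rfl⟩
  refine ⟨ofGraph (crossGraph a b), hrow, hcol, ⟨(0, 0), (1, 1), hadj, by simp, by simp⟩,
    isSeparableState_densityMatrix (edgeCount_pos hadj) (Or.inl hrow) ?_⟩
  have h : (ofGraph.{u} (crossGraph a b)).partialTranspose.onGrid =
      (ofGraph.{u} (crossGraph a b)).onGrid := by
    ext x y
    rw [partialTranspose_onGrid_adj, ofGraph_onGrid]
    change _ + _ = 1 ∧ _ ↔ _ + _ = 1 ∧ _
    rw [add_comm]
  rw [DegreeCriterion, degreeMatrix, degreeMatrix, h]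

/-- A single diagonal edge is moved to the opposite diagonal, which isolates `(0, 0)` and breaks the
degree criterion. -/
lemma exists_stratified_not_separable (a b : ℕ) : ∃ G : GridLabelledGraph.{u} (a + 2) (b + 2),
    G.RowStratified ∧ G.ColumnStratified ∧ (∃ x y, G.DiagonalEdge x y) ∧
      ¬ IsSeparableState G.densityMatrix := by
  classical
  set H : SimpleGraph (Fin (a + 2) × Fin (b + 2)) := SimpleGraph.edge (0, 0) (1, 1) with hH
  have hHadj : ∀ x y, H.Adj x y → x = (0, 0) ∧ y = (1, 1) ∨ x = (1, 1) ∧ y = (0, 0) := by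
    intro x y h
    rw [hH, SimpleGraph.edge_adj] at h
    tauto
  have hadj : (ofGraph.{u} H).onGrid.Adj (0, 0) (1, 1) := by
    rw [ofGraph_onGrid, hH, SimpleGraph.edge_adj]
    simp
  refine ⟨ofGraph H, ?_, ?_, ⟨(0, 0), (1, 1), hadj, by simp, by simp⟩, fun hsep => ?_⟩
  · rintro x y ⟨h, -, -⟩
    rw [ofGraph_onGrid] at h
    rcases hHadj x y h with ⟨rfl, rfl⟩ | ⟨rfl, rfl⟩ <;> simp
  · rintro x y ⟨h, -, -⟩
    rw [ofGraph_onGrid] at h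
    rcases hHadj x y h with ⟨rfl, rfl⟩ | ⟨rfl, rfl⟩ <;> simp
  · have hD := degreeCriterion_of_posSemidef (edgeCount_pos hadj) (partialTransposeA_posSemidef hsep)
    have h0 := (degreeCriterion_iff _).1 hD (0, 0)
    have hpos : 0 < (ofGraph.{u} H).onGrid.degree (0, 0) :=
      ((ofGraph.{u} H).onGrid.degree_pos_iff_exists_adj _).2 ⟨_, hadj⟩
    rw [h0, SimpleGraph.degree_pos_iff_exists_adj] at hpos
    obtain ⟨y, hy⟩ := hpos
    rw [partialTranspose_onGrid_adj, ofGraph_onGrid] at hy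
    rcases hHadj _ _ hy with ⟨h1, h2⟩ | ⟨h1, h2⟩ <;> simp [Prod.ext_iff] at h1 h2

end GridLabelledGraph

theorem mainTheorem2 :
    (∀ (a b : ℕ) (G : GridLabelledGraph.{u} a b), 0 < G.edgeCount →
      (G.RowStratified ∨ G.ColumnStratified) →
        (IsSeparableState G.densityMatrix ↔ G.DegreeCriterion) ∧
        (IsSeparableState G.densityMatrix ↔ (partialTransposeA G.densityMatrix).PosSemidef) ∧
        (IsSeparableState G.densityMatrix ↔ (partialTransposeB G.densityMatrix).PosSemidef)) ∧
    (∀ a b : ℕ, 2 ≤ a → 2 ≤ b →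
      (∃ G : GridLabelledGraph.{u} a b, G.RowStratified ∧ G.ColumnStratified ∧
        (∃ x y, G.DiagonalEdge x y) ∧ IsSeparableState G.densityMatrix) ∧
      (∃ G : GridLabelledGraph.{u} a b, G.RowStratified ∧ G.ColumnStratified ∧
        (∃ x y, G.DiagonalEdge x y) ∧ ¬ IsSeparableState G.densityMatrix)) := by
  constructor
  · intro a b G hG hS
    have hAB : partialTransposeB G.densityMatrix = partialTransposeA G.densityMatrix :=
      partialTransposeB_eq_partialTransposeA_of_isSymm G.isSymm_densityMatrix
    have hDS := GridLabelledGraph.isSeparableState_densityMatrix hG hS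
    have hSP := G.partialTransposeA_posSemidef
    have hPD := GridLabelledGraph.degreeCriterion_of_posSemidef hG
    rw [hAB]
    exact ⟨⟨fun h => hPD (hSP h), hDS⟩, ⟨hSP, fun h => hDS (hPD h)⟩, ⟨hSP, fun h => hDS (hPD h)⟩⟩
  · intro a b ha hb
    obtain ⟨a, rfl⟩ := Nat.exists_eq_add_of_le' ha
    obtain ⟨b, rfl⟩ := Nat.exists_eq_add_of_le' hb
    exact ⟨GridLabelledGraph.exists_stratified_separable a b,
      GridLabelledGraph.exists_stratified_not_separable a b⟩
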